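/- Let $n\ge 1$ and $0\le k\le n$. Write $\mathbb P=\mathbb P^{n-1}$ for the complex projective space and $\mathbb G=\mathbb G(k,n)$ for the Grassmannian of $k$-dimensional subspaces of $\mathbb C^n$. Their complex cohomology algebras are taken in the presentations $$H^\bullet(\mathbb P)=\mathbb C[\sigma]/\langle\sigma^n\rangle,\qquad H^\bullet(\mathbb G)=\mathbb C[\xi_1,\dots,\xi_k]^{\mathfrak S_k}/\langle h_{n-k+1},\dots,h_n\rangle,$$ where $\sigma$ is the hyperplane class, $\xi_1,\dots,\xi_k$ are the Chern roots of the dual of the tautological bundle on $\mathbb G$, and $h_j$ is the $j$-th complete homogeneous symmetric polynomial in $\xi_1,\dots,\xi_k$ (for $k=0$ there are no relations). For a partition $\lambda=(\lambda_1\ge\dots\ge\lambda_k\ge 0)$ with $\lambda_1\le n-k$ the Schubert class $\sigma_\lambda\in H^\bullet(\mathbb G)$ is the class of the Schur polynomial $$\frac{\det\left(\xi_i^{\lambda_j+k-j}\right)_{1\le i,j\le k}}{\prod_{i<j}(\xi_i-\xi_j)}.$$ Let $\int_{\mathbb P}$ be the linear functional on $H^\bullet(\mathbb P)$ with $\int_{\mathbb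 P}\sigma^{n-1}=1$ and $\int_{\mathbb P}\sigma^m=0$ for $m\neq n-1$. Let $\int_{\mathbb G}$ be the linear functional on $H^\bullet(\mathbb G)$ which vanishes on the classes of homogeneous symmetric polynomials of degree different from $\dim_{\mathbb C}\mathbb G=k(n-k)$ and takes the value $1$ on the class of a point, $\sigma_{(n-k,\dots,n-k)}$. Both functionals exist and are unique. Let $\eta_{\mathbb P}(u,v)=\int_{\mathbb P}uv$ and $\eta_{\mathbb G}(u,v)=\int_{\mathbb G}uv$ be the Poincaré pairings, and let $\eta_{\mathbb P}^{\wedge k}$ be the bilinear form on $\bigwedge^kH^\bullet(\mathbb P)$ given by $$\eta_{\mathbb P}^{\wedge k}(\alpha_1\wedge\dots\wedge\alpha_k,\ \beta_1\wedge\dots\wedge\beta_k)=\det\left(\eta_{\mathbb P}(\alpha_i,\beta_j)\right)_{1\le i,j\le k}.$$ Then there is a unique $\mathbb C$-linear map $$\mathcal I\colon\bigwedge\nolimits^kH^\bullet(\mathbb P)\to H^\bullet(\mathbb G),\qquad \mathcal I(\sigma^{\nu_1}\wedge\dots\wedge\sigma^{\nu_k})=\sigma_{\tilde\nu},\quad \tilde\nu=(\nu_1-k+1,\nu_2-k+2,\dots,\nu_k),$$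 for all integers $n-1\ge\nu_1>\nu_2>\dots>\nu_k\ge 0$. It is an isomorphism of vector spaces, and it is an isometry from $(-1)^{\binom k2}\eta_{\mathbb P}^{\wedge k}$ to $\eta_{\mathbb G}$: $$\eta_{\mathbb G}(\mathcal I x,\mathcal I y)=(-1)^{\binom k2}\,\eta_{\mathbb P}^{\wedge k}(x,y)\qquad\text{for all }x,y\in\bigwedge\nolimits^kH^\bullet(\mathbb P).$$ -/

import Mathlib

open scoped Polynomial

noncomputable section

namespace Satake

/-! ### Schur polynomials -/

/-- The alternant `det (ξ_i ^ (λ_j + k - j))` for `1 ≤ i, j ≤ k`. Rows and columns are numbered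
from `0` here, so that the exponent in column `j` is `λ_j + (k - 1 - j)`. -/
def alternant (k : ℕ) (lam : Fin k → ℕ) : MvPolynomial (Fin k) ℂ :=
  (Matrix.of fun i j : Fin k =>
    (MvPolynomial.X i : MvPolynomial (Fin k) ℂ) ^ (lam j + (k - 1 - (j : ℕ)))).det

/-- The product `∏_{i < j} (ξ_i - ξ_j)`. -/
def vandermondeProd (k : ℕ) : MvPolynomial (Fin k) ℂ :=
  ∏ p ∈ (Finset.univ : Finset (Fin k × Fin k)).filter (fun p => p.1 < p.2),
    ((MvPolynomial.X p.1 : MvPolynomial (Fin k) ℂ) - MvPolynomial.X p.2)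

theorem X_sub_X_ne_zero {k : ℕ} {i j : Fin k} (h : i ≠ j) :
    (MvPolynomial.X i : MvPolynomial (Fin k) ℂ) - MvPolynomial.X j ≠ 0 := by
  intro h0
  exact h (MvPolynomial.X_injective (R := ℂ) (sub_eq_zero.mp h0))

theorem vandermondeProd_ne_zero (k : ℕ) : vandermondeProd k ≠ 0 := by
  unfold vandermondeProd
  rw [Finset.prod_ne_zero_iff]
  intro p hp
  exact X_sub_X_ne_zero (ne_of_lt (Finset.mem_filter.mp hp).2)

theorem irreducible_X_sub_X {k : ℕ} {i j : Fin k} (h : i ≠ j) :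
    Irreducible ((MvPolynomial.X i : MvPolynomial (Fin k) ℂ) - MvPolynomial.X j) := by
  have hdeg : ((MvPolynomial.X i : MvPolynomial (Fin k) ℂ) - MvPolynomial.X j).totalDegree = 1 :=
    ((MvPolynomial.isHomogeneous_X ℂ i).sub (MvPolynomial.isHomogeneous_X ℂ j)).totalDegree
      (X_sub_X_ne_zero h)
  refine MvPolynomial.irreducible_of_totalDegree_eq_one hdeg ?_
  intro x hx
  have h1 := hx (Finsupp.single i 1)
  have hne : Finsupp.single j 1 ≠ (Finsupp.single i 1 : Fin k →₀ ℕ) := by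
    intro e
    exact h (Finsupp.single_left_injective one_ne_zero e).symm
  rw [MvPolynomial.coeff_sub, MvPolynomial.coeff_X, MvPolynomial.coeff_X, if_pos rfl,
    if_neg hne, sub_zero] at h1
  exact isUnit_of_dvd_one h1

theorem vandermondeProd_dvd_alternant (k : ℕ) (lam : Fin k → ℕ) :
    vandermondeProd k ∣ alternant k lam := by
  unfold vandermondeProd
  refine Finset.prod_dvd_of_isRelPrime ?_ ?_
  · rintro ⟨i, j⟩ hp ⟨a, b⟩ hq hne
    have hij : i < j := by simpa using hp
    have hab : a < b := by simpa using hq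
    refine ((irreducible_X_sub_X (ne_of_lt hij)).isRelPrime_iff_not_dvd).mpr ?_
    rintro ⟨c, hc⟩
    have hev := congrArg (MvPolynomial.eval
      (fun t : Fin k => (((if t = j then i else t : Fin k) : ℕ) : ℂ))) hc
    simp only [map_sub, map_mul, MvPolynomial.eval_X, if_true, if_neg (ne_of_lt hij), sub_self,
      zero_mul, sub_eq_zero, Nat.cast_inj] at hev
    apply hne
    rw [Prod.mk.injEq]
    split_ifs at hev with h1 h2 h2 <;> grind
  · rintro ⟨i, j⟩ hp
    have hij : i < j := by simpa using hp
    rw [← Ideal.mem_span_singleton, ← Ideal.Quotient.eq_zero_iff_mem, alternant, RingHom.map_det]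
    refine Matrix.det_zero_of_row_eq (ne_of_lt hij) ?_
    have hX : Ideal.Quotient.mk (Ideal.span
        {(MvPolynomial.X i : MvPolynomial (Fin k) ℂ) - MvPolynomial.X j}) (MvPolynomial.X i) =
        Ideal.Quotient.mk _ (MvPolynomial.X j) :=
      Ideal.Quotient.eq.mpr (Ideal.mem_span_singleton_self _)
    funext t
    simp [RingHom.mapMatrix_apply, hX]

/-- The Schur polynomial `s_λ = det (ξ_i ^ (λ_j + k - j)) / ∏_{i < j} (ξ_i - ξ_j)`: the quotient
of the exact division in the polynomial ring. -/
def schurPoly (k : ℕ) (lam : Fin k → ℕ) : MvPolynomial (Fin k) ℂ :=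
  Classical.choose (vandermondeProd_dvd_alternant k lam)

theorem vandermondeProd_mul_schurPoly (k : ℕ) (lam : Fin k → ℕ) :
    vandermondeProd k * schurPoly k lam = alternant k lam :=
  (Classical.choose_spec (vandermondeProd_dvd_alternant k lam)).symm

theorem rename_alternant (k : ℕ) (lam : Fin k → ℕ) (e : Equiv.Perm (Fin k)) :
    MvPolynomial.rename e (alternant k lam) =
      ((Equiv.Perm.sign e : ℤ) : MvPolynomial (Fin k) ℂ) * alternant k lam := by
  unfold alternant
  rw [← Matrix.det_permute, AlgHom.map_det]
  congr 1
  ext1 i j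
  simp [AlgHom.mapMatrix_apply]

theorem vandermondeProd_eq_alternant (k : ℕ) :
    vandermondeProd k = alternant k (fun _ => 0) := by
  have h := Matrix.det_projVandermonde (fun _ : Fin k => (1 : MvPolynomial (Fin k) ℂ))
    (fun i => MvPolynomial.X i)
  simp only [one_mul] at h
  have h2 : alternant k (fun _ => 0) = (Matrix.projVandermonde
      (fun _ : Fin k => (1 : MvPolynomial (Fin k) ℂ)) (fun i => MvPolynomial.X i)).det := by
    unfold alternant
    congr 1
    ext1 i j
    rw [Matrix.projVandermonde_apply, Matrix.of_apply, one_pow, one_mul, Fin.val_rev]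
    have hj := j.isLt
    exact congrArg _ (by lia)
  rw [h2, h, vandermondeProd, Finset.prod_filter, ← Finset.univ_product_univ, Finset.prod_product]
  refine Finset.prod_congr rfl fun i _ => ?_
  rw [← Finset.prod_filter]
  exact Finset.prod_congr (by ext j; simp) fun _ _ => rfl

theorem schurPoly_isSymmetric (k : ℕ) (lam : Fin k → ℕ) :
    (schurPoly k lam).IsSymmetric := by
  intro e
  have h := congrArg (MvPolynomial.rename e) (vandermondeProd_mul_schurPoly k lam)
  rw [map_mul, rename_alternant, vandermondeProd_eq_alternant, rename_alternant,
    ← vandermondeProd_eq_alternant, ← vandermondeProd_mul_schurPoly, mul_assoc] at h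
  have hs : ((Equiv.Perm.sign e : ℤ) : MvPolynomial (Fin k) ℂ) ≠ 0 := by
    rcases Int.units_eq_one_or (Equiv.Perm.sign e) with h1 | h1 <;> simp [h1]
  exact mul_left_cancel₀ (vandermondeProd_ne_zero k) (mul_left_cancel₀ hs h)

/-! ### The cohomology algebra of the Grassmannian -/

/-- The ideal `⟨h_{n-k+1}, …, h_n⟩` of the ring of symmetric polynomials in `ξ_1, …, ξ_k`, with
`h_m` the complete homogeneous symmetric polynomial of degree `m`. -/
def relationIdeal (k n : ℕ) : Ideal (MvPolynomial.symmetricSubalgebra (Fin k) ℂ) :=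
  Ideal.span {f | ∃ m : ℕ, n - k + 1 ≤ m ∧ m ≤ n ∧
    (f : MvPolynomial (Fin k) ℂ) = MvPolynomial.hsymm (Fin k) ℂ m}

/-- The cohomology algebra `H^•(G(k,n)) = ℂ[ξ_1, …, ξ_k]^{S_k} / ⟨h_{n-k+1}, …, h_n⟩` of the
Grassmannian of `k`-dimensional subspaces of `ℂ^n`, where `ξ_1, …, ξ_k` are the Chern roots of the
dual of the tautological bundle. -/
abbrev CohG (k n : ℕ) : Type :=
  MvPolynomial.symmetricSubalgebra (Fin k) ℂ ⧸ relationIdeal k n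

/-- The Schubert class `σ_λ`: the class of the Schur polynomial. -/
def schubertClass (k n : ℕ) (lam : Fin k → ℕ) : CohG k n :=
  Ideal.Quotient.mk (relationIdeal k n) ⟨schurPoly k lam, schurPoly_isSymmetric k lam⟩

/-- `φ` is the integration `∫_{G(k,n)}`: it vanishes on the classes of complex degree other than
the dimension `k (n - k)`, each `ξ_i` having complex degree `1`, and it takes the value `1` on the
class of a point, which is the Schubert class of the full `k × (n - k)` rectangle. -/
def IsIntegralG (k n : ℕ) (φ : CohG k n →ₗ[ℂ] ℂ) : Prop :=
  (∀ (f : MvPolynomial.symmetricSubalgebra (Fin k) ℂ) (m : ℕ),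
      (f : MvPolynomial (Fin k) ℂ).IsHomogeneous m → m ≠ k * (n - k) →
        φ (Ideal.Quotient.mk (relationIdeal k n) f) = 0) ∧
    φ (schubertClass k n fun _ => n - k) = 1

/-! ### The cohomology algebra of the projective space -/

/-- The cohomology algebra `H^•(ℙ^{n-1}) = ℂ[σ] / ⟨σ^n⟩`. -/
abbrev CohP (n : ℕ) : Type :=
  ℂ[X] ⧸ Ideal.span {(Polynomial.X : ℂ[X]) ^ n}

/-- The hyperplane class `σ ∈ H²(ℙ^{n-1})`. -/
def hyperplaneClass (n : ℕ) : CohP n :=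
  Ideal.Quotient.mk _ Polynomial.X

/-- `φ` is the integration `∫_{ℙ^{n-1}}`: it vanishes on the powers `σ^m` with `m ≠ n - 1`, and it
takes the value `1` on the class `σ^{n-1}` of a point. -/
def IsIntegralP (n : ℕ) (φ : CohP n →ₗ[ℂ] ℂ) : Prop :=
  (∀ m : ℕ, m ≠ n - 1 → φ (hyperplaneClass n ^ m) = 0) ∧ φ (hyperplaneClass n ^ (n - 1)) = 1

/-! ### Poincaré pairings and exterior powers -/

/-- The Poincaré pairing `η(u, v) = ∫ u ∪ v` attached to an integration map on a cohomology
algebra. -/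
def poincarePairing {A : Type} [CommRing A] [Algebra ℂ A] (φ : A →ₗ[ℂ] ℂ) :
    LinearMap.BilinForm ℂ A :=
  (LinearMap.mul ℂ A).compr₂ φ

theorem poincarePairing_apply {A : Type} [CommRing A] [Algebra ℂ A] (φ : A →ₗ[ℂ] ℂ) (u v : A) :
    poincarePairing φ u v = φ (u * v) := rfl

/-- The bilinear form `η^{∧k}` induced by `η` on the `k`-th exterior power. -/
def wedgeForm {A : Type} [CommRing A] [Algebra ℂ A] (η : LinearMap.BilinForm ℂ A) (k : ℕ) :
    LinearMap.BilinForm ℂ (⋀[ℂ]^k A) :=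
  exteriorPower.pairingDual ℂ A k ∘ₗ exteriorPower.map k η

/-- `η^{∧k} (α_1 ∧ … ∧ α_k, β_1 ∧ … ∧ β_k) = det (η (α_i, β_j))`, which determines `η^{∧k}`. -/
theorem wedgeForm_apply {A : Type} [CommRing A] [Algebra ℂ A] (η : LinearMap.BilinForm ℂ A)
    (k : ℕ) (α β : Fin k → A) :
    wedgeForm η k (exteriorPower.ιMulti ℂ k α) (exteriorPower.ιMulti ℂ k β) =
      (Matrix.of fun i j : Fin k => η (α i) (β j)).det := by
  rw [← Matrix.det_transpose]
  simp only [wedgeForm, LinearMap.comp_apply, exteriorPower.map_apply_ιMulti,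
    exteriorPower.pairingDual_ιMulti_ιMulti]
  rfl

end Satake

end

noncomputable section

namespace Satake

/-! Write Δ for `vandermondeProd k`. Everything rests on the alternating map `bialternant`, which
sends `X^{ν_1}, …, X^{ν_k}` to det(ξ_i^{ν_j}) / Δ and is linear over symmetric polynomials; for
decreasing ν it gives the Schur polynomial of ν̃.

The relations enter through one identity, `X_pow_eq_sum_hsymm`: ξ_i^n = ∑_{a<k} h_{n-a} q_a(ξ_i),
with q_a = `hornerPoly k a`. Inserted in a column, it shows that a bialternant with an exponent ≥ n
lies in the relation ideal, so the map descends to ⋀^k of ℂ[σ]/σ^n (`exists_satakeMap`). It is onto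
because bialternants span the symmetric polynomials (`span_bialternant`).

Integration on the Grassmannian is the residue formula `topCoeff`: (-1)^{k(k-1)/2}/k! times the
coefficient of (ξ_1⋯ξ_k)^{n-1} in fΔ². It kills the relations since, by Cramer's rule for the same
identity, h_{n-a}Δ ∈ ⟨ξ_1^n, …, ξ_k^n⟩. In the pairing of two bialternants Δ² cancels both
denominators, and the coefficient of the product of alternants is k! det([ν_i + μ_j = n-1]), a
determinant of pairings on projective space (`topCoeff_mul_bialternant`). This is the isometry;
injectivity follows since the wedge form is nondegenerate. -/

/-- The ring `ℂ[ξ_1, …, ξ_k]^{S_k}` of symmetric polynomials. -/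
abbrev SymPoly (k : ℕ) : Type := MvPolynomial.symmetricSubalgebra (Fin k) ℂ

/-! ### Alternants and bialternants with symmetric coefficients -/

/-- The generalised alternant `det (p_j (ξ_i))` of polynomials with symmetric coefficients. -/
def evalDet (k : ℕ) : (SymPoly k)[X] [⋀^Fin k]→ₗ[SymPoly k] MvPolynomial (Fin k) ℂ :=
  { toFun := fun p => (Matrix.of fun i j : Fin k =>
      Polynomial.aeval (MvPolynomial.X i : MvPolynomial (Fin k) ℂ) (p j)).det
    map_update_add' := by
      intro inst p j x y
      obtain rfl : inst = instDecidableEqFin k := Subsingleton.elim _ _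
      have h : ∀ z, (Matrix.of fun i j' : Fin k => Polynomial.aeval
          (MvPolynomial.X i : MvPolynomial (Fin k) ℂ) (Function.update p j z j')) =
          Matrix.updateCol (Matrix.of fun i j' : Fin k => Polynomial.aeval
            (MvPolynomial.X i : MvPolynomial (Fin k) ℂ) (p j')) j
            (fun i => Polynomial.aeval (MvPolynomial.X i : MvPolynomial (Fin k) ℂ) z) := by
        intro z
        ext1 i j'
        by_cases hj : j' = j
        · subst hj; simp
        · simp [hj]
      rw [h, h, h, ← Matrix.det_updateCol_add]
      congr 2
      funext i
      exact map_add _ _ _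
    map_update_smul' := by
      intro inst p j c x
      obtain rfl : inst = instDecidableEqFin k := Subsingleton.elim _ _
      have h : ∀ z, (Matrix.of fun i j' : Fin k => Polynomial.aeval
          (MvPolynomial.X i : MvPolynomial (Fin k) ℂ) (Function.update p j z j')) =
          Matrix.updateCol (Matrix.of fun i j' : Fin k => Polynomial.aeval
            (MvPolynomial.X i : MvPolynomial (Fin k) ℂ) (p j')) j
            (fun i => Polynomial.aeval (MvPolynomial.X i : MvPolynomial (Fin k) ℂ) z) := by
        intro z
        ext1 i j'
        by_cases hj : j' = j
        · subst hj; simp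
        · simp [hj]
      rw [h, h, Algebra.smul_def c (Matrix.det _), ← Matrix.det_updateCol_smul]
      congr 2
      funext i
      rw [map_smul, Algebra.smul_def]
      rfl
    map_eq_zero_of_eq' := by
      intro p a b hab hne
      exact Matrix.det_zero_of_column_eq hne fun i => by simp [hab] }

theorem evalDet_apply (k : ℕ) (p : Fin k → (SymPoly k)[X]) :
    evalDet k p = (Matrix.of fun i j : Fin k =>
      Polynomial.aeval (MvPolynomial.X i : MvPolynomial (Fin k) ℂ) (p j)).det := rfl

/-- The factors ξ_i - ξ_j are pairwise coprime, and modulo each of them two rows of `M` coincide. -/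
theorem vandermondeProd_dvd_det {k : ℕ} (M : Matrix (Fin k) (Fin k) (MvPolynomial (Fin k) ℂ))
    (hM : ∀ i j c, MvPolynomial.X i - MvPolynomial.X j ∣ M i c - M j c) :
    vandermondeProd k ∣ M.det := by
  unfold vandermondeProd
  refine Finset.prod_dvd_of_isRelPrime ?_ ?_
  · rintro ⟨i, j⟩ hp ⟨a, b⟩ hq hne
    have hij : i < j := by simpa using hp
    have hab : a < b := by simpa using hq
    refine ((irreducible_X_sub_X (ne_of_lt hij)).isRelPrime_iff_not_dvd).mpr ?_
    rintro ⟨c, hc⟩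
    -- At the point with distinct coordinates, except that the j-th is set equal to the i-th, only
    -- the factor for the pair (i, j) vanishes.
    have hev := congrArg (MvPolynomial.eval
      (fun t : Fin k => (((if t = j then i else t : Fin k) : ℕ) : ℂ))) hc
    simp only [map_sub, map_mul, MvPolynomial.eval_X, if_true, if_neg (ne_of_lt hij), sub_self,
      zero_mul, sub_eq_zero, Nat.cast_inj] at hev
    apply hne
    rw [Prod.mk.injEq]
    split_ifs at hev with h1 h2 h2 <;> grind
  · rintro ⟨i, j⟩ hp
    have hij : i < j := by simpa using hp
    rw [← Ideal.mem_span_singleton, ← Ideal.Quotient.eq_zero_iff_mem, RingHom.map_det]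
    refine Matrix.det_zero_of_row_eq (ne_of_lt hij) ?_
    funext t
    exact Ideal.Quotient.eq.mpr (Ideal.mem_span_singleton.mpr (hM i j t))

theorem vandermondeProd_dvd_evalDet (k : ℕ) (p : Fin k → (SymPoly k)[X]) :
    vandermondeProd k ∣ evalDet k p := by
  rw [evalDet_apply]
  refine vandermondeProd_dvd_det _ fun i j c => ?_
  simp only [Matrix.of_apply, Polynomial.aeval_def, Polynomial.eval₂_eq_eval_map]
  exact Polynomial.sub_dvd_eval_sub _ _ _

theorem rename_vandermondeProd (k : ℕ) (e : Equiv.Perm (Fin k)) :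
    MvPolynomial.rename e (vandermondeProd k) =
      ((Equiv.Perm.sign e : ℤ) : MvPolynomial (Fin k) ℂ) * vandermondeProd k := by
  rw [vandermondeProd_eq_alternant, rename_alternant]

theorem rename_aeval_X {k : ℕ} (e : Equiv.Perm (Fin k)) (i : Fin k) (p : (SymPoly k)[X]) :
    MvPolynomial.rename e (Polynomial.aeval (MvPolynomial.X i : MvPolynomial (Fin k) ℂ) p) =
      Polynomial.aeval (MvPolynomial.X (e i) : MvPolynomial (Fin k) ℂ) p := by
  induction p using Polynomial.induction_on' with
  | add p q hp hq => simp [hp, hq]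
  | monomial m c =>
    have hc : MvPolynomial.rename e (c : MvPolynomial (Fin k) ℂ) = c := c.2 e
    simp only [Polynomial.aeval_monomial, map_mul, map_pow, MvPolynomial.rename_X]
    congr 1

theorem rename_evalDet (k : ℕ) (p : Fin k → (SymPoly k)[X]) (e : Equiv.Perm (Fin k)) :
    MvPolynomial.rename e (evalDet k p) =
      ((Equiv.Perm.sign e : ℤ) : MvPolynomial (Fin k) ℂ) * evalDet k p := by
  rw [evalDet_apply, ← Matrix.det_permute, AlgHom.map_det]
  congr 1
  ext1 i j
  simp [AlgHom.mapMatrix_apply, rename_aeval_X]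

/-- Both Δ and `g` change by the sign of the permutation, and the two signs cancel in the quotient.
-/
theorem isSymmetric_of_vandermondeProd_mul {k : ℕ} {f g : MvPolynomial (Fin k) ℂ}
    (hfg : vandermondeProd k * f = g) (hg : ∀ e : Equiv.Perm (Fin k), MvPolynomial.rename e g =
      ((Equiv.Perm.sign e : ℤ) : MvPolynomial (Fin k) ℂ) * g) : f.IsSymmetric := by
  intro e
  have h := congrArg (MvPolynomial.rename e) hfg
  rw [map_mul, rename_vandermondeProd, hg, ← hfg, mul_assoc] at h
  have hs : ((Equiv.Perm.sign e : ℤ) : MvPolynomial (Fin k) ℂ) ≠ 0 := by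
    rcases Int.units_eq_one_or (Equiv.Perm.sign e) with h1 | h1 <;> simp [h1]
  exact mul_left_cancel₀ (vandermondeProd_ne_zero k) (mul_left_cancel₀ hs h)

/-- Multiplication by the Vandermonde product, from symmetric to alternating polynomials. -/
def mulVandermonde (k : ℕ) : SymPoly k →ₗ[SymPoly k] MvPolynomial (Fin k) ℂ :=
  LinearMap.toSpanSingleton (SymPoly k) (MvPolynomial (Fin k) ℂ) (vandermondeProd k)

theorem mulVandermonde_injective (k : ℕ) : Function.Injective (mulVandermonde k) := by
  intro f g h
  exact Subtype.ext (mul_right_cancel₀ (vandermondeProd_ne_zero k) h)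

theorem evalDet_mem_range (k : ℕ) (p : Fin k → (SymPoly k)[X]) :
    evalDet k p ∈ LinearMap.range (mulVandermonde k) := by
  obtain ⟨f, hf⟩ := vandermondeProd_dvd_evalDet k p
  exact ⟨⟨f, isSymmetric_of_vandermondeProd_mul hf.symm (rename_evalDet k p)⟩,
    (mul_comm _ _).trans hf.symm⟩

/-- The bialternant `det (p_j (ξ_i)) / ∏_{i < j} (ξ_i - ξ_j)` as a multilinear alternating map. -/
def bialternant (k : ℕ) : (SymPoly k)[X] [⋀^Fin k]→ₗ[SymPoly k] SymPoly k :=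
  { toFun := fun p => (evalDet_mem_range k p).choose
    map_update_add' := by
      intro inst p j x y
      obtain rfl : inst = instDecidableEqFin k := Subsingleton.elim _ _
      -- The quotient by Δ is unique, so linearity can be checked after multiplying by Δ, where it
      -- is that of `evalDet`.
      apply mulVandermonde_injective k
      rw [map_add]
      simp only [(evalDet_mem_range k _).choose_spec]
      exact AlternatingMap.map_update_add _ _ _ _ _
    map_update_smul' := by
      intro inst p j c x
      obtain rfl : inst = instDecidableEqFin k := Subsingleton.elim _ _
      apply mulVandermonde_injective k
      rw [map_smul]
      simp only [(evalDet_mem_range k _).choose_spec]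
      exact AlternatingMap.map_update_smul _ _ _ _ _
    map_eq_zero_of_eq' := by
      intro p a b hab hne
      apply mulVandermonde_injective k
      rw [(evalDet_mem_range k _).choose_spec, map_zero,
        AlternatingMap.map_eq_zero_of_eq _ _ hab hne] }

theorem bialternant_mul_vandermondeProd (k : ℕ) (p : Fin k → (SymPoly k)[X]) :
    (bialternant k p : MvPolynomial (Fin k) ℂ) * vandermondeProd k = evalDet k p :=
  (evalDet_mem_range k p).choose_spec

theorem eq_bialternant_iff {k : ℕ} {p : Fin k → (SymPoly k)[X]} {f : SymPoly k} :
    f = bialternant k p ↔ (f : MvPolynomial (Fin k) ℂ) * vandermondeProd k = evalDet k p := by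
  rw [← bialternant_mul_vandermondeProd]
  exact ⟨fun h => by rw [h], fun h => mulVandermonde_injective k h⟩

theorem evalDet_X_pow (k : ℕ) (m : Fin k → ℕ) :
    evalDet k (fun j => Polynomial.X ^ m j) = (Matrix.of fun i j : Fin k =>
      (MvPolynomial.X i : MvPolynomial (Fin k) ℂ) ^ m j).det := by
  simp [evalDet_apply]

theorem coe_bialternant_X_pow {k : ℕ} (ν lam : Fin k → ℕ)
    (h : ∀ j, ν j = lam j + (k - 1 - (j : ℕ))) :
    (⟨schurPoly k lam, schurPoly_isSymmetric k lam⟩ : SymPoly k) =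
      bialternant k (fun j => Polynomial.X ^ ν j) := by
  rw [eq_bialternant_iff, evalDet_X_pow, mul_comm, vandermondeProd_mul_schurPoly, alternant]
  simp only [h]

theorem bialternant_delta (k : ℕ) :
    bialternant k (fun j => Polynomial.X ^ (k - 1 - (j : ℕ))) = 1 := by
  rw [eq_comm, eq_bialternant_iff, evalDet_X_pow, OneMemClass.coe_one, one_mul,
    vandermondeProd_eq_alternant, alternant]
  simp

/-! ### Complete homogeneous symmetric polynomials -/

theorem hsymm_eq_coeff_prod (k m : ℕ) : MvPolynomial.hsymm (Fin k) ℂ m =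
    PowerSeries.coeff m (∏ i : Fin k, PowerSeries.mk fun a =>
      (MvPolynomial.X i : MvPolynomial (Fin k) ℂ) ^ a) := by
  rw [PowerSeries.coeff_prod, MvPolynomial.hsymm]
  refine Finset.sum_bij' (fun s _ => Multiset.toFinsupp s.1)
    (fun l hl => ⟨Finsupp.toMultiset l, ?_⟩) ?_ ?_ ?_ ?_ ?_
  · simp only [Finset.mem_finsuppAntidiag] at hl
    rw [Finsupp.card_toMultiset, Finsupp.sum_fintype _ _ (fun _ => rfl)]
    exact hl.1
  · intro s _
    refine Finset.mem_finsuppAntidiag.mpr ⟨?_, Finset.subset_univ _⟩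
    exact (Multiset.sum_count_eq_card (by simp)).trans s.2
  · exact fun _ _ => Finset.mem_univ _
  · intro s _
    exact Subtype.ext (by simp)
  · intro l _
    simp
  · intro s _
    simp only [PowerSeries.coeff_mk, Multiset.toFinsupp_apply]
    rw [Finset.prod_multiset_map_count]
    exact Finset.prod_subset (Finset.subset_univ _) fun i _ hi => by
      rw [Multiset.count_eq_zero_of_notMem (by simpa using hi), pow_zero]

/-- The power series `∏ (1 - ξ_i t)`. -/
def chernSeries (k : ℕ) : PowerSeries (MvPolynomial (Fin k) ℂ) :=
  ∏ i : Fin k, (1 - PowerSeries.C (MvPolynomial.X i) * PowerSeries.X)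

theorem geomSeries_mul {R : Type*} [CommRing R] (x : R) :
    (PowerSeries.mk fun a => x ^ a) * (1 - PowerSeries.C x * PowerSeries.X) = 1 := by
  ext m
  rw [mul_sub, mul_one, ← mul_assoc, mul_right_comm, map_sub]
  cases m with
  | zero => simp
  | succ m => simp [PowerSeries.coeff_succ_mul_X, PowerSeries.coeff_one, pow_succ]

theorem coeff_chernSeries_isSymmetric (k b : ℕ) :
    (PowerSeries.coeff b (chernSeries k)).IsSymmetric := by
  intro e
  have h : PowerSeries.map (MvPolynomial.rename e : _ →ₐ[ℂ] _).toRingHom (chernSeries k) =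
      chernSeries k := by
    rw [chernSeries, map_prod]
    refine Fintype.prod_equiv e _ _ fun i => ?_
    simp [PowerSeries.map_C]
  conv_rhs => rw [← h]
  rw [PowerSeries.coeff_map]
  rfl

/-- The coefficients of `∏ (1 - ξ_i t)`, i.e. the signed elementary symmetric polynomials. -/
def chernCoeff (k b : ℕ) : SymPoly k :=
  ⟨PowerSeries.coeff b (chernSeries k), coeff_chernSeries_isSymmetric k b⟩

theorem chernCoeff_zero (k : ℕ) : chernCoeff k 0 = 1 := by
  refine Subtype.ext ?_
  simp [chernCoeff, chernSeries, PowerSeries.coeff_zero_eq_constantCoeff_apply, map_prod]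

/-- The polynomials `t^a - e_1 t^(a-1) + … ± e_a`. -/
def hornerPoly (k a : ℕ) : (SymPoly k)[X] :=
  ∑ p ∈ Finset.HasAntidiagonal.antidiagonal a, Polynomial.C (chernCoeff k p.1) * Polynomial.X ^ p.2

theorem hornerPoly_monic (k a : ℕ) :
    (hornerPoly k a).Monic ∧ (hornerPoly k a).natDegree = a := by
  have hdeg : (hornerPoly k a).natDegree ≤ a := by
    refine Polynomial.natDegree_sum_le_of_forall_le _ _ fun p hp => ?_
    refine (Polynomial.natDegree_C_mul_X_pow_le _ _).trans ?_
    have := Finset.HasAntidiagonal.mem_antidiagonal.mp hp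
    lia
  have hc : (hornerPoly k a).coeff a = 1 := by
    rw [hornerPoly, Polynomial.finsetSum_coeff, Finset.sum_eq_single (0, a)]
    · simp [chernCoeff_zero]
    · rintro ⟨b, c⟩ hp hne
      have := Finset.HasAntidiagonal.mem_antidiagonal.mp hp
      rw [Polynomial.coeff_C_mul_X_pow, if_neg]
      rintro rfl
      exact hne (by simp at this; simp [this])
    · simp
  refine ⟨Polynomial.monic_of_natDegree_le_of_coeff_eq_one a hdeg hc, le_antisymm hdeg ?_⟩
  exact Polynomial.le_natDegree_of_ne_zero (by rw [hc]; exact one_ne_zero)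

/-- Multiplying `chernSeries` by the geometric series of ξ_i t cancels its factor 1 - ξ_i t. -/
theorem aeval_hornerPoly {k : ℕ} (a : ℕ) (i : Fin k) :
    Polynomial.aeval (MvPolynomial.X i : MvPolynomial (Fin k) ℂ) (hornerPoly k a) =
      PowerSeries.coeff a (∏ j ∈ Finset.univ.erase i,
        (1 - PowerSeries.C (MvPolynomial.X j : MvPolynomial (Fin k) ℂ) * PowerSeries.X)) := by
  have h : (∏ j ∈ Finset.univ.erase i,
      (1 - PowerSeries.C (MvPolynomial.X j : MvPolynomial (Fin k) ℂ) * PowerSeries.X)) =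
      chernSeries k * PowerSeries.mk fun a => (MvPolynomial.X i : MvPolynomial (Fin k) ℂ) ^ a := by
    rw [chernSeries, ← Finset.mul_prod_erase _ _ (Finset.mem_univ i), mul_comm, ← mul_assoc,
      geomSeries_mul, one_mul]
  rw [h, PowerSeries.coeff_mul, hornerPoly, map_sum]
  refine Finset.sum_congr rfl fun p _ => ?_
  rw [map_mul, Polynomial.aeval_C, PowerSeries.coeff_mk, map_pow, Polynomial.aeval_X]
  rfl

/-- The product over j ≠ i is a polynomial in t of degree at most k - 1. -/
theorem aeval_hornerPoly_eq_zero {k : ℕ} {a : ℕ} (ha : k ≤ a) (i : Fin k) :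
    Polynomial.aeval (MvPolynomial.X i : MvPolynomial (Fin k) ℂ) (hornerPoly k a) = 0 := by
  rw [aeval_hornerPoly]
  have h : (∏ j ∈ Finset.univ.erase i,
      (1 - PowerSeries.C (MvPolynomial.X j : MvPolynomial (Fin k) ℂ) * PowerSeries.X)) =
      ((∏ j ∈ Finset.univ.erase i,
        (1 - Polynomial.C (MvPolynomial.X j : MvPolynomial (Fin k) ℂ) * Polynomial.X) :
        (MvPolynomial (Fin k) ℂ)[X]) : PowerSeries (MvPolynomial (Fin k) ℂ)) := by
    rw [← Polynomial.coeToPowerSeries.ringHom_apply, map_prod]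
    simp
  rw [h, Polynomial.coeff_coe]
  refine Polynomial.coeff_eq_zero_of_natDegree_lt (lt_of_le_of_lt
    (Polynomial.natDegree_prod_le _ _) ?_)
  have hi := i.isLt
  refine lt_of_le_of_lt (Finset.sum_le_card_nsmul _ _ 1 fun j _ => ?_) ?_
  · refine (Polynomial.natDegree_sub_le _ _).trans ?_
    simp
  · rw [Finset.card_erase_of_mem (Finset.mem_univ i), Finset.card_univ, Fintype.card_fin]
    lia

/-- This is the coefficient of t^n in 1/(1 - ξ_i t) = ∏_{j≠i}(1 - ξ_j t) · ∑ h_m t^m. Only a < k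
contributes, so the h_{n-a} that occur are exactly the defining relations. -/
theorem X_pow_eq_sum_hsymm {k n : ℕ} (hkn : k ≤ n) (i : Fin k) :
    (MvPolynomial.X i : MvPolynomial (Fin k) ℂ) ^ n =
      ∑ a : Fin k, MvPolynomial.hsymm (Fin k) ℂ (n - a) *
        Polynomial.aeval (MvPolynomial.X i : MvPolynomial (Fin k) ℂ) (hornerPoly k a) := by
  have h : (PowerSeries.mk fun a => (MvPolynomial.X i : MvPolynomial (Fin k) ℂ) ^ a) =
      (∏ j ∈ Finset.univ.erase i,
        (1 - PowerSeries.C (MvPolynomial.X j : MvPolynomial (Fin k) ℂ) * PowerSeries.X)) *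
      ∏ i : Fin k, PowerSeries.mk fun a => (MvPolynomial.X i : MvPolynomial (Fin k) ℂ) ^ a := by
    rw [← Finset.mul_prod_erase _ _ (Finset.mem_univ i), mul_left_comm, ← Finset.prod_mul_distrib,
      Finset.prod_eq_one fun j _ => (mul_comm _ _).trans (geomSeries_mul _), mul_one]
  have h2 := congrArg (PowerSeries.coeff n) h
  rw [PowerSeries.coeff_mk, PowerSeries.coeff_mul, Finset.Nat.sum_antidiagonal_eq_sum_range_succ_mk]
    at h2
  simp only [← aeval_hornerPoly, ← hsymm_eq_coeff_prod] at h2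
  rw [h2, Fin.sum_univ_eq_sum_range (n := k) (fun a => MvPolynomial.hsymm (Fin k) ℂ (n - a) *
      Polynomial.aeval (MvPolynomial.X i : MvPolynomial (Fin k) ℂ) (hornerPoly k a))]
  symm
  simp only [mul_comm (MvPolynomial.hsymm _ _ _)]
  refine Finset.sum_subset (Finset.range_mono (by lia)) fun a _ ha => ?_
  rw [aeval_hornerPoly_eq_zero (by simpa using ha), zero_mul]

/-! ### The relations in the Grassmannian cohomology -/

/-- Reversal inverts every pair, so position j contributes j inversions. -/
theorem sign_revPerm (k : ℕ) :
    Equiv.Perm.sign (Fin.revPerm : Equiv.Perm (Fin k)) = (-1) ^ k.choose 2 := by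
  rw [Equiv.Perm.sign_eq_prod_prod_Iio]
  have h : ∀ j : Fin k, (∏ i ∈ Finset.Iio j, if (Fin.revPerm i : Fin k) < Fin.revPerm j then
      (1 : ℤˣ) else -1) = (-1) ^ (j : ℕ) := by
    intro j
    rw [Finset.prod_congr rfl (g := fun _ => -1), Finset.prod_const, Fin.card_Iio]
    intro i hi
    rw [if_neg]
    simpa using (Finset.mem_Iio.mp hi).le
  rw [Finset.prod_congr rfl fun j _ => h j, Finset.prod_pow_eq_pow_sum,
    Fin.sum_univ_eq_sum_range (fun i => i), Finset.sum_range_id, Nat.choose_two_right]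

/-- The ideal `⟨ξ_1^n, …, ξ_k^n⟩`. -/
def powIdeal (k n : ℕ) : Ideal (MvPolynomial (Fin k) ℂ) :=
  Ideal.span (Set.range fun i : Fin k => (MvPolynomial.X i : MvPolynomial (Fin k) ℂ) ^ n)

theorem X_pow_mem_powIdeal {k n : ℕ} (i : Fin k) {m : ℕ} (h : n ≤ m) :
    (MvPolynomial.X i : MvPolynomial (Fin k) ℂ) ^ m ∈ powIdeal k n := by
  rw [← Nat.add_sub_cancel' h, pow_add]
  exact Ideal.mul_mem_right _ _ (Ideal.subset_span ⟨i, rfl⟩)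

theorem coeff_eq_zero_of_mem_powIdeal {k n : ℕ} {f : MvPolynomial (Fin k) ℂ}
    (hf : f ∈ powIdeal k n) {d : Fin k →₀ ℕ} (hd : ∀ i, d i < n) : f.coeff d = 0 := by
  obtain ⟨c, rfl⟩ := Ideal.mem_span_range_iff_exists_fun.mp hf
  rw [MvPolynomial.coeff_sum]
  refine Finset.sum_eq_zero fun i _ => ?_
  rw [MvPolynomial.X_pow_eq_monomial, MvPolynomial.coeff_mul_monomial', if_neg]
  intro h
  have := h i
  rw [Finsupp.single_eq_same] at this
  exact absurd (hd i) (by lia)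

/-- The q_a are monic of degree a, so column operations turn them into 1, X, …, X^{k-1}. The sign
arises because Δ is the alternant with decreasing exponents. -/
theorem evalDet_hornerPoly (k : ℕ) :
    evalDet k (fun a => hornerPoly k a) =
      ((Equiv.Perm.sign (Fin.revPerm : Equiv.Perm (Fin k)) : ℤ) : MvPolynomial (Fin k) ℂ) *
        vandermondeProd k := by
  have h1 := Matrix.det_eval_matrixOfPolynomials_eq_det_vandermonde
    (fun i : Fin k => (MvPolynomial.X i : MvPolynomial (Fin k) ℂ))
    (fun a => (hornerPoly k a).map (algebraMap (SymPoly k) (MvPolynomial (Fin k) ℂ)))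
    (fun a => by rw [(hornerPoly_monic k a).1.natDegree_map, (hornerPoly_monic k a).2])
    (fun a => (hornerPoly_monic k a).1.map _)
  have h2 : evalDet k (fun a => hornerPoly k a) = (Matrix.vandermonde
      (fun i : Fin k => (MvPolynomial.X i : MvPolynomial (Fin k) ℂ))).det := by
    rw [h1, evalDet_apply]
    simp only [Polynomial.aeval_def, Polynomial.eval₂_eq_eval_map]
  rw [h2, vandermondeProd_eq_alternant, alternant]
  have h3 := Matrix.det_permute' (Fin.revPerm : Equiv.Perm (Fin k)) (Matrix.of fun i j : Fin k =>
    (MvPolynomial.X i : MvPolynomial (Fin k) ℂ) ^ (0 + (k - 1 - (j : ℕ))))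
  rw [← h3]
  congr 1
  ext1 i j
  have := j.isLt
  simp only [Matrix.vandermonde_apply, Matrix.submatrix_apply, Matrix.of_apply, Fin.revPerm_apply,
    Fin.val_rev, id]
  exact congrArg _ (by lia)

/-- Cramer's rule: the matrix (q_a(ξ_i)) has determinant ±Δ and sends the vector (h_{n-a}) to
(ξ_i^n). -/
theorem hsymm_mul_vandermondeProd_mem {k n : ℕ} (hkn : k ≤ n) (a : Fin k) :
    MvPolynomial.hsymm (Fin k) ℂ (n - a) * vandermondeProd k ∈ powIdeal k n := by
  set M : Matrix (Fin k) (Fin k) (MvPolynomial (Fin k) ℂ) := Matrix.of fun i j =>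
    Polynomial.aeval (MvPolynomial.X i : MvPolynomial (Fin k) ℂ) (hornerPoly k j) with hM
  set h : Fin k → MvPolynomial (Fin k) ℂ := fun a => MvPolynomial.hsymm (Fin k) ℂ (n - a) with hh
  have hMh : M.mulVec h = fun i => (MvPolynomial.X i : MvPolynomial (Fin k) ℂ) ^ n := by
    funext i
    rw [X_pow_eq_sum_hsymm hkn i]
    change ∑ j, M i j * h j = _
    exact Finset.sum_congr rfl fun j _ => mul_comm _ _
  have h1 : M.det • h = M.adjugate.mulVec (fun i => MvPolynomial.X i ^ n) := by
    rw [← hMh, Matrix.mulVec_mulVec, Matrix.adjugate_mul, Matrix.smul_mulVec, Matrix.one_mulVec]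
  have h2 : M.det * h a ∈ powIdeal k n := by
    have h3 := congrFun h1 a
    rw [Pi.smul_apply, smul_eq_mul] at h3
    rw [h3]
    change ∑ i, M.adjugate a i * _ ∈ _
    exact Ideal.sum_mem _ fun i _ => Ideal.mul_mem_left _ _ (X_pow_mem_powIdeal i le_rfl)
  have h4 : M.det = _ := evalDet_hornerPoly k
  rw [h4, mul_right_comm, mul_assoc] at h2
  rcases Int.units_eq_one_or (Equiv.Perm.sign (Fin.revPerm : Equiv.Perm (Fin k))) with hs | hs
  · simpa [hs, mul_comm] using h2
  · simpa [hs, mul_comm] using h2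

theorem mul_vandermondeProd_mem {k n : ℕ} (hkn : k ≤ n) {f : SymPoly k}
    (hf : f ∈ relationIdeal k n) : (f : MvPolynomial (Fin k) ℂ) * vandermondeProd k ∈
      powIdeal k n := by
  unfold relationIdeal at hf
  induction hf using Submodule.span_induction with
  | mem x hx =>
    obtain ⟨m, h1, h2, h3⟩ := hx
    rw [h3]
    have := hsymm_mul_vandermondeProd_mem hkn (⟨n - m, by lia⟩ : Fin k)
    rwa [show n - (n - m) = m by lia] at this
  | zero => simp
  | add x y _ _ hx hy =>
    rw [Subalgebra.coe_add, add_mul]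
    exact add_mem hx hy
  | smul a x _ hx =>
    rw [smul_eq_mul, Subalgebra.coe_mul, mul_assoc]
    exact Ideal.mul_mem_left _ _ hx

/-- The complete homogeneous symmetric polynomial, as an element of the ring of symmetric
polynomials. -/
def hsymmSym (k m : ℕ) : SymPoly k :=
  ⟨MvPolynomial.hsymm (Fin k) ℂ m, MvPolynomial.hsymm_isSymmetric _ _ _⟩

theorem hsymmSym_mem {k n : ℕ} (hkn : k ≤ n) (a : Fin k) :
    hsymmSym k (n - a) ∈ relationIdeal k n :=
  Ideal.subset_span ⟨n - a, by lia, by lia, rfl⟩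

theorem bialternant_congr {k : ℕ} {p q : Fin k → (SymPoly k)[X]}
    (h : ∀ i j : Fin k, Polynomial.aeval (MvPolynomial.X i : MvPolynomial (Fin k) ℂ) (p j) =
      Polynomial.aeval (MvPolynomial.X i : MvPolynomial (Fin k) ℂ) (q j)) :
    bialternant k p = bialternant k q := by
  rw [eq_bialternant_iff, bialternant_mul_vandermondeProd, evalDet_apply, evalDet_apply]
  simp only [h]

theorem bialternant_X_pow_mem {k n : ℕ} (hkn : k ≤ n) {m : Fin k → ℕ} {j : Fin k} (hj : n ≤ m j) :
    bialternant k (fun j => Polynomial.X ^ m j) ∈ relationIdeal k n := by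
  -- The new column differs from X^{m_j} as a polynomial but has the same value at every ξ_i, which
  -- is all that `bialternant` sees.
  have h : bialternant k (fun j => Polynomial.X ^ m j) =
      bialternant k (Function.update (fun j => Polynomial.X ^ m j) j (∑ a : Fin k,
        hsymmSym k (n - a) • (hornerPoly k a * Polynomial.X ^ (m j - n)))) := by
    refine bialternant_congr fun i j' => ?_
    rcases eq_or_ne j' j with rfl | hne
    · rw [Function.update_self, map_pow, Polynomial.aeval_X, map_sum]
      conv_lhs => rw [← Nat.add_sub_cancel' hj, pow_add, X_pow_eq_sum_hsymm hkn i, Finset.sum_mul]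
      refine Finset.sum_congr rfl fun a _ => ?_
      rw [map_smul, map_mul, map_pow, Polynomial.aeval_X, Algebra.smul_def, mul_assoc]
      rfl
    · rw [Function.update_of_ne hne]
  rw [h, AlternatingMap.map_update_sum]
  refine Ideal.sum_mem _ fun a _ => ?_
  rw [AlternatingMap.map_update_smul, smul_eq_mul]
  exact Ideal.mul_mem_right _ _ (hsymmSym_mem hkn a)

/-! ### Spanning by bialternants -/

/-- Antisymmetrizing a monomial yields the alternant with its exponents. -/
theorem exists_bialternant_eq_antisymmetrization (k : ℕ) (g : MvPolynomial (Fin k) ℂ) :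
    ∃ b ∈ Submodule.span ℂ (Set.range fun m : Fin k → ℕ =>
      bialternant k fun j => Polynomial.X ^ m j),
      (b : MvPolynomial (Fin k) ℂ) * vandermondeProd k = ∑ e : Equiv.Perm (Fin k),
        ((Equiv.Perm.sign e : ℤ) : MvPolynomial (Fin k) ℂ) * MvPolynomial.rename e g := by
  induction g using MvPolynomial.induction_on' with
  | monomial m c =>
    refine ⟨c • bialternant k fun j => Polynomial.X ^ m j,
      Submodule.smul_mem _ _ (Submodule.subset_span ⟨m, rfl⟩), ?_⟩
    rw [Subalgebra.coe_smul, Algebra.smul_mul_assoc, bialternant_mul_vandermondeProd,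
      evalDet_X_pow, Matrix.det_apply', Finset.smul_sum]
    refine Finset.sum_congr rfl fun e _ => ?_
    have h : (MvPolynomial.monomial m c : MvPolynomial (Fin k) ℂ) =
        c • ∏ i, MvPolynomial.X i ^ m i := by
      rw [MvPolynomial.monomial_eq, Finsupp.prod_fintype _ _ (fun i => pow_zero _),
        MvPolynomial.smul_eq_C_mul]
    rw [h, map_smul, map_prod, mul_smul_comm]
    simp
  | add p q hp hq =>
    obtain ⟨b, hb, hb'⟩ := hp
    obtain ⟨c, hc, hc'⟩ := hq
    refine ⟨b + c, add_mem hb hc, ?_⟩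
    simp only [Subalgebra.coe_add, add_mul, hb', hc', map_add, mul_add, Finset.sum_add_distrib]

/-- Since fΔ is alternating, its antisymmetrization is k! fΔ; division by k! recovers f. -/
theorem span_bialternant (k : ℕ) : Submodule.span ℂ (Set.range fun m : Fin k → ℕ =>
    bialternant k fun j => Polynomial.X ^ m j) = ⊤ := by
  refine eq_top_iff.mpr fun f _ => ?_
  obtain ⟨b, hb, hb'⟩ := exists_bialternant_eq_antisymmetrization k
    ((f : MvPolynomial (Fin k) ℂ) * vandermondeProd k)
  have h : ∀ e : Equiv.Perm (Fin k), ((Equiv.Perm.sign e : ℤ) : MvPolynomial (Fin k) ℂ) *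
      MvPolynomial.rename e ((f : MvPolynomial (Fin k) ℂ) * vandermondeProd k) =
      (f : MvPolynomial (Fin k) ℂ) * vandermondeProd k := by
    intro e
    have hf : MvPolynomial.rename e (f : MvPolynomial (Fin k) ℂ) = f := f.2 e
    rw [map_mul, rename_vandermondeProd, hf]
    rcases Int.units_eq_one_or (Equiv.Perm.sign e) with hs | hs <;> simp [hs]
  rw [Finset.sum_congr rfl fun e _ => h e, Finset.sum_const, Finset.card_univ, Fintype.card_perm,
    Fintype.card_fin, ← smul_mul_assoc] at hb'
  have hbf : b = k.factorial • f :=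
    Subtype.ext (mul_right_cancel₀ (vandermondeProd_ne_zero k) hb')
  have hk : ((k.factorial : ℕ) : ℂ) ≠ 0 := Nat.cast_ne_zero.mpr k.factorial_ne_zero
  have h2 : f = ((k.factorial : ℕ) : ℂ)⁻¹ • b := by
    rw [hbf, ← Nat.cast_smul_eq_nsmul ℂ, smul_smul, inv_mul_cancel₀ hk, one_smul]
  rw [h2]
  exact Submodule.smul_mem _ _ hb

/-! ### Descent of linear maps to quotient algebras -/

/-- Here φ is only ℂ-linear, so it is composed with a ℂ-linear section of the quotient map. -/
theorem exists_quotient_lift {R M : Type} [CommRing R] [Algebra ℂ R] [AddCommGroup M] [Module ℂ M]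
    (I : Ideal R) (φ : R →ₗ[ℂ] M) (h : ∀ x ∈ I, φ x = 0) :
    ∃ ψ : (R ⧸ I) →ₗ[ℂ] M, ∀ x, ψ (Ideal.Quotient.mk I x) = φ x := by
  obtain ⟨s, hs⟩ := (Ideal.Quotient.mkₐ ℂ I).toLinearMap.exists_rightInverse_of_surjective
    (LinearMap.range_eq_top.mpr (Ideal.Quotient.mkₐ_surjective ℂ I))
  refine ⟨φ ∘ₗ s, fun x => ?_⟩
  have h1 : Ideal.Quotient.mk I (s (Ideal.Quotient.mk I x)) = Ideal.Quotient.mk I x :=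
    LinearMap.congr_fun hs (Ideal.Quotient.mk I x)
  rw [LinearMap.comp_apply, ← sub_eq_zero, ← map_sub]
  exact h _ (Ideal.Quotient.eq.mp h1)

/-! ### The projective space -/

theorem hyperplaneClass_pow (n m : ℕ) :
    hyperplaneClass n ^ m = Ideal.Quotient.mk _ (Polynomial.X ^ m) := rfl

theorem hyperplaneClass_pow_eq_zero {n m : ℕ} (h : n ≤ m) : hyperplaneClass n ^ m = 0 := by
  rw [hyperplaneClass_pow, Ideal.Quotient.eq_zero_iff_mem, Ideal.mem_span_singleton]
  exact pow_dvd_pow _ h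

/-- The basis `1, σ, …, σ^{n-1}` of the cohomology of the projective space. -/
def basisP (n : ℕ) : Module.Basis (Fin n) ℂ (CohP n) :=
  (AdjoinRoot.powerBasis' (Polynomial.monic_X_pow (R := ℂ) n)).basis.reindex
    (finCongr (Polynomial.natDegree_X_pow n))

theorem basisP_apply (n : ℕ) (i : Fin n) : basisP n i = hyperplaneClass n ^ (i : ℕ) := by
  have h := (AdjoinRoot.powerBasis' (Polynomial.monic_X_pow (R := ℂ) n)).basis_eq_pow
    ((finCongr (Polynomial.natDegree_X_pow (R := ℂ) n)).symm i)
  rw [AdjoinRoot.powerBasis'_gen] at h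
  have h2 := Module.Basis.reindex_apply
    (AdjoinRoot.powerBasis' (Polynomial.monic_X_pow (R := ℂ) n)).basis
    (finCongr (Polynomial.natDegree_X_pow (R := ℂ) n)) i
  exact h2.trans h

theorem existsUnique_integralP {n : ℕ} (hn : 0 < n) :
    ∃! φ : CohP n →ₗ[ℂ] ℂ, IsIntegralP n φ := by
  obtain ⟨ψ, hψ⟩ := exists_quotient_lift (Ideal.span {(Polynomial.X : ℂ[X]) ^ n})
    (Polynomial.lcoeff ℂ (n - 1)) (by
      intro x hx
      obtain ⟨c, rfl⟩ := Ideal.mem_span_singleton.mp hx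
      rw [Polynomial.lcoeff_apply, Polynomial.coeff_X_pow_mul', if_neg (by lia)])
  refine ⟨ψ, ⟨fun m hm => ?_, ?_⟩, fun φ hφ => (basisP n).ext fun i => ?_⟩
  · rw [hyperplaneClass_pow, hψ, Polynomial.lcoeff_apply, Polynomial.coeff_X_pow, if_neg hm.symm]
  · rw [hyperplaneClass_pow, hψ, Polynomial.lcoeff_apply, Polynomial.coeff_X_pow, if_pos rfl]
  · rw [basisP_apply]
    rcases eq_or_ne (i : ℕ) (n - 1) with h | h
    · rw [h, hφ.2, hyperplaneClass_pow, hψ, Polynomial.lcoeff_apply, Polynomial.coeff_X_pow,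
        if_pos rfl]
    · rw [hφ.1 _ h, hyperplaneClass_pow, hψ, Polynomial.lcoeff_apply, Polynomial.coeff_X_pow,
        if_neg h.symm]

theorem integralP_pow {n : ℕ} {φ : CohP n →ₗ[ℂ] ℂ} (hφ : IsIntegralP n φ) (m : ℕ) :
    φ (hyperplaneClass n ^ m) = if m = n - 1 then 1 else 0 := by
  split_ifs with h
  · rw [h, hφ.2]
  · exact hφ.1 m h

/-! ### Exterior powers of the cohomology of the projective space -/

theorem wedge_ext {k n : ℕ} {M : Type} [AddCommGroup M] [Module ℂ M]
    {L L' : (⋀[ℂ]^k (CohP n)) →ₗ[ℂ] M}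
    (h : ∀ ν : Fin k → ℕ, StrictAnti ν → (∀ i, ν i ≤ n - 1) →
      L (exteriorPower.ιMulti ℂ k fun i => hyperplaneClass n ^ ν i) =
        L' (exteriorPower.ιMulti ℂ k fun i => hyperplaneClass n ^ ν i)) : L = L' := by
  -- The exterior basis lists its indices increasingly; the dual order turns this into decreasing
  -- exponents.
  refine (((basisP n).reindex OrderDual.toDual).exteriorPower k).ext fun s => ?_
  rw [exteriorPower.basis_apply, exteriorPower.ιMulti_family]
  have h1 : ((basisP n).reindex OrderDual.toDual ∘ (Set.powersetCard.ofFinEmbEquiv.symm s)) =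
      fun i => hyperplaneClass n ^
        ((OrderDual.ofDual (Set.powersetCard.ofFinEmbEquiv.symm s i) : Fin n) : ℕ) := by
    funext i
    rw [Function.comp_apply, Module.Basis.reindex_apply, basisP_apply]
    rfl
  rw [h1]
  refine h _ (fun i j hij => ?_) fun i => Nat.le_sub_one_of_lt (Fin.isLt _)
  exact (Set.powersetCard.ofFinEmbEquiv.symm s).strictMono hij

theorem exists_satakeMap {k n : ℕ} (hkn : k ≤ n) :
    ∃ I : (⋀[ℂ]^k (CohP n)) →ₗ[ℂ] CohG k n, ∀ ν : Fin k → ℕ,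
      I (exteriorPower.ιMulti ℂ k fun i => hyperplaneClass n ^ ν i) =
        Ideal.Quotient.mk _ (bialternant k fun j => Polynomial.X ^ ν j) := by
  -- `s` lifts a class to its remainder modulo X^n; it is linear, not multiplicative.
  obtain ⟨s, hs⟩ := exists_quotient_lift (M := (SymPoly k)[X]) (Ideal.span {(Polynomial.X : ℂ[X]) ^ n})
    ((Polynomial.mapAlgHom (Algebra.ofId ℂ (SymPoly k))).toLinearMap ∘ₗ
      Polynomial.modByMonicHom ((Polynomial.X : ℂ[X]) ^ n)) (by
      intro x hx
      have h := (Polynomial.modByMonic_eq_zero_iff_dvd (Polynomial.monic_X_pow n)).mpr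
        (Ideal.mem_span_singleton.mp hx)
      rw [LinearMap.comp_apply, Polynomial.modByMonicHom_apply, h, map_zero])
  have hs' : ∀ m < n, s (hyperplaneClass n ^ m) = Polynomial.X ^ m := by
    intro m hm
    rw [hyperplaneClass_pow, hs, LinearMap.comp_apply, Polynomial.modByMonicHom_apply,
      (Polynomial.modByMonic_eq_self_iff (Polynomial.monic_X_pow n)).mpr (by
        rw [Polynomial.degree_X_pow, Polynomial.degree_X_pow]
        exact_mod_cast hm)]
    simp
  let D : (CohP n) [⋀^Fin k]→ₗ[ℂ] CohG k n :=
    ((Ideal.Quotient.mkₐ ℂ (relationIdeal k n)).toLinearMap.compAlternatingMap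
      { (bialternant k).toMultilinearMap.restrictScalars ℂ with
        map_eq_zero_of_eq' := fun _ _ _ h hne => (bialternant k).map_eq_zero_of_eq _ h hne }
      ).compLinearMap s
  refine ⟨exteriorPower.alternatingMapLinearEquiv D, fun ν => ?_⟩
  rw [exteriorPower.alternatingMapLinearEquiv_apply_ιMulti]
  by_cases h : ∀ j, ν j < n
  · simp only [D, AlternatingMap.compLinearMap_apply, hs' _ (h _)]
    rfl
  -- With an exponent ≥ n both sides vanish, so the formula holds for arbitrary ν.
  · push Not at h
    obtain ⟨j, hj⟩ := h
    rw [Ideal.Quotient.eq_zero_iff_mem.mpr (bialternant_X_pow_mem hkn hj)]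
    exact D.map_coord_zero j (hyperplaneClass_pow_eq_zero hj)

theorem satakeMap_surjective {k n : ℕ} {I : (⋀[ℂ]^k (CohP n)) →ₗ[ℂ] CohG k n}
    (hI : ∀ ν : Fin k → ℕ,
      I (exteriorPower.ιMulti ℂ k fun i => hyperplaneClass n ^ ν i) =
        Ideal.Quotient.mk _ (bialternant k fun j => Polynomial.X ^ ν j)) :
    Function.Surjective I := by
  have h : Submodule.span ℂ (Set.range fun m : Fin k → ℕ =>
      bialternant k fun j => Polynomial.X ^ m j) ≤
      (LinearMap.range I).comap (Ideal.Quotient.mkₐ ℂ (relationIdeal k n)).toLinearMap := by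
    rw [Submodule.span_le]
    rintro _ ⟨m, rfl⟩
    exact ⟨_, hI m⟩
  intro x
  obtain ⟨f, rfl⟩ := Ideal.Quotient.mk_surjective x
  exact h (span_bialternant k ▸ Submodule.mem_top : f ∈ _)

/-! ### Decreasing exponents and Schubert classes -/

theorem strictAnti_add_val_le {k : ℕ} {ν : Fin k → ℕ} (hν : StrictAnti ν) {i j : Fin k}
    (hij : i ≤ j) : ν j + j ≤ ν i + i := by
  obtain ⟨j, hj⟩ := j
  induction j with
  | zero =>
    have : i = ⟨0, hj⟩ := Fin.ext (Nat.le_zero.mp hij)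
    rw [this]
  | succ j ih =>
    rcases hij.eq_or_lt with rfl | h
    · exact le_rfl
    · have h1 := ih (by lia) (Fin.mk_le_mk.mpr (Nat.le_of_lt_succ h) : i ≤ ⟨j, _⟩)
      have h2 : ν ⟨j + 1, hj⟩ < ν ⟨j, by lia⟩ := hν (Fin.mk_lt_mk.mpr (Nat.lt_succ_self j))
      simp only at h1 ⊢
      lia

/-- Strict decrease forces ν_j ≥ k - 1 - j, so the truncated subtraction defining ν̃ loses nothing.
-/
theorem strictAnti_eq_add_rev {k : ℕ} {ν : Fin k → ℕ} (hν : StrictAnti ν) (j : Fin k) :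
    ν j = (ν j + ((j : ℕ) + 1) - k) + (k - 1 - (j : ℕ)) := by
  have hj := j.isLt
  have h := strictAnti_add_val_le hν (j := ⟨k - 1, by lia⟩) (Nat.le_sub_one_of_lt hj)
  simp only at h
  lia

theorem schubertClass_eq {k n : ℕ} {ν : Fin k → ℕ} (hν : StrictAnti ν) :
    schubertClass k n (fun j => ν j + ((j : ℕ) + 1) - k) =
      Ideal.Quotient.mk _ (bialternant k fun j => Polynomial.X ^ ν j) := by
  rw [schubertClass, coe_bialternant_X_pow ν _ (strictAnti_eq_add_rev hν)]

/-! ### Integration on the Grassmannian -/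

section

attribute [local instance] MvPolynomial.gradedAlgebra

/-- The component of fg in degree d + e is (the degree-d component of f) · g; cancel g. -/
theorem isHomogeneous_of_mul {σ : Type*} {f g : MvPolynomial σ ℂ} {d e : ℕ}
    (hg : g.IsHomogeneous e) (hg0 : g ≠ 0) (hfg : (f * g).IsHomogeneous (d + e)) :
    f.IsHomogeneous d := by
  have h := DirectSum.coe_decompose_mul_add_of_right_mem (i := d) (a := f)
    (MvPolynomial.homogeneousSubmodule σ ℂ) (j := e) (b := g) hg
  rw [DirectSum.decompose_of_mem_same _ hfg] at h
  have h2 := mul_right_cancel₀ hg0 h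
  rw [h2]
  exact (DirectSum.decompose (MvPolynomial.homogeneousSubmodule σ ℂ) f d).2

end

theorem isHomogeneous_evalDet_X_pow {k : ℕ} (m : Fin k → ℕ) :
    (evalDet k fun j => Polynomial.X ^ m j).IsHomogeneous (∑ j, m j) := by
  rw [evalDet_X_pow, Matrix.det_apply']
  refine MvPolynomial.IsHomogeneous.sum _ _ _ fun e _ => ?_
  rw [← map_intCast (MvPolynomial.C : ℂ →+* MvPolynomial (Fin k) ℂ)]
  exact (MvPolynomial.IsHomogeneous.prod _ _ _ fun i _ =>
    MvPolynomial.isHomogeneous_X_pow _ _).C_mul _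

theorem vandermondeProd_eq_evalDet (k : ℕ) :
    vandermondeProd k = evalDet k fun j => Polynomial.X ^ (k - 1 - (j : ℕ)) := by
  rw [← bialternant_mul_vandermondeProd, bialternant_delta, OneMemClass.coe_one, one_mul]

theorem isHomogeneous_vandermondeProd (k : ℕ) :
    (vandermondeProd k).IsHomogeneous (∑ j : Fin k, (k - 1 - (j : ℕ))) := by
  rw [vandermondeProd_eq_evalDet]
  exact isHomogeneous_evalDet_X_pow _

theorem isHomogeneous_bialternant {k : ℕ} {ν : Fin k → ℕ} (hν : StrictAnti ν) :
    (bialternant k fun j => Polynomial.X ^ ν j : MvPolynomial (Fin k) ℂ).IsHomogeneous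
      (∑ j, (ν j + ((j : ℕ) + 1) - k)) := by
  refine isHomogeneous_of_mul (isHomogeneous_vandermondeProd k) (vandermondeProd_ne_zero k) ?_
  rw [bialternant_mul_vandermondeProd, ← Finset.sum_add_distrib,
    ← Finset.sum_congr rfl fun j _ => strictAnti_eq_add_rev hν j]
  exact isHomogeneous_evalDet_X_pow ν

theorem sum_rev_mul_two (k : ℕ) : (∑ j : Fin k, (k - 1 - (j : ℕ))) * 2 = k * (k - 1) := by
  rw [Fin.sum_univ_eq_sum_range (fun j => k - 1 - j), Finset.sum_range_reflect (fun j => j),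
    Finset.sum_range_id_mul_two]

/-- The exponent `(n - 1, …, n - 1)`. -/
def topExponent (k n : ℕ) : Fin k →₀ ℕ := Finsupp.equivFunOnFinite.symm fun _ => n - 1

theorem topExponent_apply (k n : ℕ) (i : Fin k) : topExponent k n i = n - 1 := rfl

/-- The coefficient of `(ξ_1 ⋯ ξ_k)^{n-1}` in `f ∏_{i < j} (ξ_i - ξ_j)²`, normalised. -/
def topCoeff (k n : ℕ) : SymPoly k →ₗ[ℂ] ℂ :=
  ((-1) ^ k.choose 2 * (k.factorial : ℂ)⁻¹) • (MvPolynomial.lcoeff ℂ (topExponent k n) ∘ₗ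
    LinearMap.mulRight ℂ (vandermondeProd k * vandermondeProd k) ∘ₗ
    (MvPolynomial.symmetricSubalgebra (Fin k) ℂ).val.toLinearMap)

theorem topCoeff_apply (k n : ℕ) (f : SymPoly k) :
    topCoeff k n f = ((-1) ^ k.choose 2 * (k.factorial : ℂ)⁻¹) *
      MvPolynomial.coeff (topExponent k n)
        ((f : MvPolynomial (Fin k) ℂ) * (vandermondeProd k * vandermondeProd k)) := rfl

/-- One factor Δ already puts f in ⟨ξ_i^n⟩, whose elements have no monomial with all exponents n -
1. -/
theorem topCoeff_eq_zero_of_mem {k n : ℕ} (hn : 0 < n) (hkn : k ≤ n) {f : SymPoly k}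
    (hf : f ∈ relationIdeal k n) : topCoeff k n f = 0 := by
  rw [topCoeff_apply, ← mul_assoc (f : MvPolynomial (Fin k) ℂ), coeff_eq_zero_of_mem_powIdeal
    (Ideal.mul_mem_right _ _ (mul_vandermondeProd_mem hkn hf)), mul_zero]
  intro i
  rw [topExponent_apply]
  lia

/-- Degree count: Δ² has degree k(k - 1), and k(n - 1) - k(k - 1) = k(n - k). -/
theorem topCoeff_eq_zero_of_isHomogeneous {k n : ℕ} (hkn : k ≤ n) {f : SymPoly k} {m : ℕ}
    (hf : (f : MvPolynomial (Fin k) ℂ).IsHomogeneous m) (hm : m ≠ k * (n - k)) :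
    topCoeff k n f = 0 := by
  have hV := isHomogeneous_vandermondeProd k
  rw [topCoeff_apply, (hf.mul (hV.mul hV)).coeff_eq_zero, mul_zero]
  rw [Finsupp.degree_eq_sum]
  simp only [topExponent_apply, Finset.sum_const, Finset.card_univ, Fintype.card_fin, smul_eq_mul]
  rw [← mul_two, sum_rev_mul_two]
  intro h
  apply hm
  obtain ⟨r, rfl⟩ := Nat.exists_eq_add_of_le hkn
  rcases k with _ | k
  · simpa using h.symm
  · have h1 : (k + 1) * (k + 1 + r - 1) = (k + 1) * r + (k + 1) * (k + 1 - 1) := by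
      rw [← mul_add]
      congr 1
      lia
    rw [Nat.add_sub_cancel_left]
    lia

/-- For each fixed `e` the inner sum is already det M; there are k! choices of `e`. -/
theorem sum_sign_mul_sign {k : ℕ} (M : Matrix (Fin k) (Fin k) ℂ) :
    ∑ e : Equiv.Perm (Fin k), ∑ e' : Equiv.Perm (Fin k),
      ((Equiv.Perm.sign e : ℤ) : ℂ) * ((Equiv.Perm.sign e' : ℤ) : ℂ) * ∏ i, M (e i) (e' i) =
      k.factorial * M.det := by
  have h : ∀ e : Equiv.Perm (Fin k), ∑ e' : Equiv.Perm (Fin k),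
      ((Equiv.Perm.sign e : ℤ) : ℂ) * ((Equiv.Perm.sign e' : ℤ) : ℂ) * ∏ i, M (e i) (e' i) =
      M.det := by
    intro e
    have h1 := Matrix.det_permute e M
    rw [← Matrix.det_transpose, Matrix.det_apply'] at h1
    simp only [mul_assoc, ← Finset.mul_sum]
    have h2 : ∑ e' : Equiv.Perm (Fin k), ((Equiv.Perm.sign e' : ℤ) : ℂ) * ∏ i, M (e i) (e' i) =
      ((Equiv.Perm.sign e : ℤ) : ℂ) * M.det := h1
    rw [h2, ← mul_assoc]
    rcases Int.units_eq_one_or (Equiv.Perm.sign e) with hs | hs <;> simp [hs]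
  rw [Finset.sum_congr rfl fun e _ => h e, Finset.sum_const, Finset.card_univ, Fintype.card_perm,
    Fintype.card_fin, nsmul_eq_mul]

theorem coeff_prod_X_pow {k : ℕ} (d : Fin k →₀ ℕ) (m : Fin k → ℕ) :
    MvPolynomial.coeff d (∏ i, (MvPolynomial.X i : MvPolynomial (Fin k) ℂ) ^ m i) =
      ∏ i, if m i = d i then 1 else 0 := by
  have h : (∏ i, (MvPolynomial.X i : MvPolynomial (Fin k) ℂ) ^ m i) =
      MvPolynomial.monomial (Finsupp.equivFunOnFinite.symm m) 1 := by
    rw [MvPolynomial.monomial_eq, Finsupp.prod_fintype _ _ (fun i => pow_zero _), map_one, one_mul]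
    rfl
  rw [h, MvPolynomial.coeff_monomial, Fintype.prod_ite_zero, Finset.prod_const_one]
  congr 1
  rw [eq_iff_iff, DFunLike.ext_iff]
  rfl

theorem topCoeff_mul_bialternant {k n : ℕ} (ν μ : Fin k → ℕ) :
    topCoeff k n ((bialternant k fun j => Polynomial.X ^ ν j) *
      bialternant k fun j => Polynomial.X ^ μ j) =
      (-1) ^ k.choose 2 *
        (Matrix.of fun i j => if ν i + μ j = n - 1 then (1 : ℂ) else 0).det := by
  have hk : ((k.factorial : ℕ) : ℂ) ≠ 0 := Nat.cast_ne_zero.mpr k.factorial_ne_zero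
  rw [topCoeff_apply, mul_assoc, mul_right_inj' (pow_ne_zero _ (by norm_num)),
    inv_mul_eq_iff_eq_mul₀ hk, ← sum_sign_mul_sign, Subalgebra.coe_mul, mul_mul_mul_comm,
    bialternant_mul_vandermondeProd, bialternant_mul_vandermondeProd, evalDet_X_pow, evalDet_X_pow,
    ← Matrix.det_transpose, Matrix.det_apply', ← Matrix.det_transpose (Matrix.of _),
    Matrix.det_apply', Finset.sum_mul_sum, MvPolynomial.coeff_sum]
  refine Finset.sum_congr rfl fun e _ => ?_
  rw [MvPolynomial.coeff_sum]
  refine Finset.sum_congr rfl fun e' _ => ?_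
  rw [mul_mul_mul_comm, ← Finset.prod_mul_distrib,
    ← map_intCast (MvPolynomial.C : ℂ →+* MvPolynomial (Fin k) ℂ),
    ← map_intCast (MvPolynomial.C : ℂ →+* MvPolynomial (Fin k) ℂ), ← map_mul,
    MvPolynomial.coeff_C_mul]
  simp only [Matrix.transpose_apply, Matrix.of_apply, ← pow_add]
  rw [coeff_prod_X_pow]
  rfl

theorem topCoeff_rectangle {k n : ℕ} (hkn : k ≤ n) :
    topCoeff k n (⟨schurPoly k fun _ => n - k, schurPoly_isSymmetric k _⟩ : SymPoly k) = 1 := by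
  have h := coe_bialternant_X_pow (fun j : Fin k => n - 1 - j) (fun _ => n - k) (fun j => by
    have := j.isLt
    lia)
  -- The rectangle is paired with 1, the bialternant of exponents k - 1 - j. The matrix is
  -- antidiagonal, and its sign cancels the normalisation.
  have h1 : (Matrix.of fun i j : Fin k => if n - 1 - (i : ℕ) + (k - 1 - (j : ℕ)) = n - 1 then
      (1 : ℂ) else 0) = (1 : Matrix (Fin k) (Fin k) ℂ).submatrix Fin.revPerm id := by
    ext1 i j
    rw [Matrix.submatrix_apply, Matrix.one_apply, Matrix.of_apply]
    refine if_congr ?_ rfl rfl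
    rw [Fin.revPerm_apply, Fin.ext_iff, Fin.val_rev, id]
    have := i.isLt
    have := j.isLt
    lia
  rw [h, ← mul_one (bialternant k _), ← bialternant_delta, topCoeff_mul_bialternant, h1,
    Matrix.det_permute, sign_revPerm, Matrix.det_one, mul_one]
  push_cast
  rw [← mul_pow, neg_one_mul, neg_neg, one_pow]

theorem exists_integralG {k n : ℕ} (hn : 0 < n) (hkn : k ≤ n) :
    ∃ φ : CohG k n →ₗ[ℂ] ℂ, IsIntegralG k n φ ∧
      ∀ f, φ (Ideal.Quotient.mk _ f) = topCoeff k n f := by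
  obtain ⟨φ, hφ⟩ := exists_quotient_lift (relationIdeal k n) (topCoeff k n)
    fun x hx => topCoeff_eq_zero_of_mem hn hkn hx
  refine ⟨φ, ⟨fun f m hf hm => ?_, ?_⟩, hφ⟩
  · rw [hφ, topCoeff_eq_zero_of_isHomogeneous hkn hf hm]
  · rw [schubertClass, hφ, topCoeff_rectangle hkn]

/-- Schubert classes span, and a partition inside the k × (n - k) rectangle of full size k(n - k) is
the rectangle itself. -/
theorem IsIntegralG.ext {k n : ℕ} (hkn : k ≤ n) {φ ψ : CohG k n →ₗ[ℂ] ℂ}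
    (hφ : IsIntegralG k n φ) (hψ : IsIntegralG k n ψ) : φ = ψ := by
  obtain ⟨I, hI⟩ := exists_satakeMap hkn
  have h : φ ∘ₗ I = ψ ∘ₗ I := by
    refine wedge_ext fun ν hν hνn => ?_
    rw [LinearMap.comp_apply, LinearMap.comp_apply, hI]
    by_cases hd : ∑ j, (ν j + ((j : ℕ) + 1) - k) = k * (n - k)
    · have hle : ∀ j : Fin k, ν j + ((j : ℕ) + 1) - k ≤ n - k := by
        intro j
        have hj := j.isLt
        have h1 := strictAnti_add_val_le hν (i := ⟨0, by lia⟩) (j := j) (Nat.zero_le _)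
        have h2 := hνn ⟨0, by lia⟩
        simp only at h1
        lia
      have heq := (Finset.sum_eq_sum_iff_of_le fun j (_ : j ∈ Finset.univ) => hle j).mp (by
        rw [hd, Finset.sum_const, Finset.card_univ, Fintype.card_fin, smul_eq_mul])
      have hfun : (fun j : Fin k => ν j + ((j : ℕ) + 1) - k) = fun _ => n - k :=
        funext fun j => heq j (Finset.mem_univ j)
      rw [← schubertClass_eq hν, hfun, hφ.2, hψ.2]
    · rw [hφ.1 _ _ (isHomogeneous_bialternant hν) hd, hψ.1 _ _ (isHomogeneous_bialternant hν) hd]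
  refine LinearMap.ext fun x => ?_
  obtain ⟨y, rfl⟩ := satakeMap_surjective hI x
  exact LinearMap.congr_fun h y

/-! ### The isometry -/

theorem satakeMap_isometry {k n : ℕ} {I : (⋀[ℂ]^k (CohP n)) →ₗ[ℂ] CohG k n}
    (hI : ∀ ν : Fin k → ℕ,
      I (exteriorPower.ιMulti ℂ k fun i => hyperplaneClass n ^ ν i) =
        Ideal.Quotient.mk _ (bialternant k fun j => Polynomial.X ^ ν j))
    {intP : CohP n →ₗ[ℂ] ℂ} (hP : IsIntegralP n intP) {intG : CohG k n →ₗ[ℂ] ℂ}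
    (hG : ∀ f, intG (Ideal.Quotient.mk _ f) = topCoeff k n f) (x y : ⋀[ℂ]^k (CohP n)) :
    poincarePairing intG (I x) (I y) =
      (-1) ^ (k.choose 2) * wedgeForm (poincarePairing intP) k x y := by
  have h : LinearMap.compl₁₂ (poincarePairing (A := CohG k n) intG) I I =
      ((-1 : ℂ) ^ (k.choose 2)) • wedgeForm (poincarePairing intP) k := by
    refine wedge_ext fun ν _ _ => wedge_ext fun μ _ _ => ?_
    rw [LinearMap.compl₁₂_apply, LinearMap.smul_apply, LinearMap.smul_apply, wedgeForm_apply, hI, hI,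
      poincarePairing_apply, ← map_mul, hG, topCoeff_mul_bialternant, smul_eq_mul]
    congr 2
    ext1 i j
    rw [Matrix.of_apply, Matrix.of_apply, poincarePairing_apply, ← pow_add, integralP_pow hP]
  exact LinearMap.congr_fun₂ h x y

/-! ### Nondegeneracy and injectivity -/

theorem eq_zero_of_wedgeForm_eq_zero {k n : ℕ} {intP : CohP n →ₗ[ℂ] ℂ} (hP : IsIntegralP n intP)
    {x : ⋀[ℂ]^k (CohP n)} (hx : ∀ y, wedgeForm (poincarePairing intP) k y x = 0) : x = 0 := by
  refine ((basisP n).exteriorPower k).ext_elem fun s => ?_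
  rw [map_zero, Finsupp.zero_apply, exteriorPower.basis_repr_apply]
  -- The classes σ^{n-1-i} are Poincaré dual to the σ^i, so pairing with their wedges reads off the
  -- coordinates of x.
  have h : poincarePairing intP ∘ (fun i => hyperplaneClass n ^
      (n - 1 - (Set.powersetCard.ofFinEmbEquiv.symm s i : ℕ))) =
      (basisP n).coord ∘ Set.powersetCard.ofFinEmbEquiv.symm s := by
    funext i
    refine (basisP n).ext fun j => ?_
    rw [Function.comp_apply, Function.comp_apply, Module.Basis.coord_apply,
      Module.Basis.repr_self, basisP_apply, poincarePairing_apply, ← pow_add, integralP_pow hP,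
      Finsupp.single_apply]
    refine if_congr ?_ rfl rfl
    rw [Fin.ext_iff]
    have := j.isLt
    have := (Set.powersetCard.ofFinEmbEquiv.symm s i).isLt
    lia
  have h2 := hx (exteriorPower.ιMulti ℂ k fun i => hyperplaneClass n ^
      (n - 1 - (Set.powersetCard.ofFinEmbEquiv.symm s i : ℕ)))
  rw [wedgeForm, LinearMap.comp_apply, exteriorPower.map_apply_ιMulti, h] at h2
  exact h2

theorem satakeMap_injective {k n : ℕ} {I : (⋀[ℂ]^k (CohP n)) →ₗ[ℂ] CohG k n}
    {intP : CohP n →ₗ[ℂ] ℂ} (hP : IsIntegralP n intP) {intG : CohG k n →ₗ[ℂ] ℂ}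
    (hI : ∀ x y, poincarePairing intG (I x) (I y) =
      (-1) ^ (k.choose 2) * wedgeForm (poincarePairing intP) k x y) : Function.Injective I := by
  refine (injective_iff_map_eq_zero I).mpr fun x hx => eq_zero_of_wedgeForm_eq_zero hP fun y => ?_
  have h := hI y x
  rw [hx, map_zero, eq_comm, mul_eq_zero] at h
  exact h.resolve_left (pow_ne_zero _ (by norm_num))

end Satake

end

/-- Integration is well defined (there is exactly one integration map on each of the two
cohomology algebras), and the linear map determined by
`σ^{ν_1} ∧ … ∧ σ^{ν_k} ↦ σ_{ν̃}`, for `n - 1 ≥ ν_1 > … > ν_k ≥ 0` and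
`ν̃ = (ν_1 - k + 1, ν_2 - k + 2, …, ν_k)`, exists, is unique, bijective, and an isometry. -/
theorem theorem5p2 (k n : ℕ) (hn : 0 < n) (hkn : k ≤ n) :
    (∃! intP : Satake.CohP n →ₗ[ℂ] ℂ, Satake.IsIntegralP n intP) ∧
    (∃! intG : Satake.CohG k n →ₗ[ℂ] ℂ, Satake.IsIntegralG k n intG) ∧
    ∀ (intP : Satake.CohP n →ₗ[ℂ] ℂ) (intG : Satake.CohG k n →ₗ[ℂ] ℂ),
      Satake.IsIntegralP n intP → Satake.IsIntegralG k n intG →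
      ∃ I : (⋀[ℂ]^k (Satake.CohP n)) ≃ₗ[ℂ] Satake.CohG k n,
        (∀ ν : Fin k → ℕ, StrictAnti ν → (∀ i, ν i ≤ n - 1) →
          I (exteriorPower.ιMulti ℂ k fun i => Satake.hyperplaneClass n ^ ν i) =
            Satake.schubertClass k n fun j => ν j + ((j : ℕ) + 1) - k) ∧
        (∀ L : (⋀[ℂ]^k (Satake.CohP n)) →ₗ[ℂ] Satake.CohG k n,
          (∀ ν : Fin k → ℕ, StrictAnti ν → (∀ i, ν i ≤ n - 1) →
            L (exteriorPower.ιMulti ℂ k fun i => Satake.hyperplaneClass n ^ ν i) =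
              Satake.schubertClass k n fun j => ν j + ((j : ℕ) + 1) - k) →
          L = I.toLinearMap) ∧
        ∀ x y : ⋀[ℂ]^k (Satake.CohP n),
          Satake.poincarePairing intG (I x) (I y) =
            (-1) ^ (k.choose 2) * Satake.wedgeForm (Satake.poincarePairing intP) k x y := by
  have uniqG := fun (φ ψ : Satake.CohG k n →ₗ[ℂ] ℂ) hφ hψ =>
    Satake.IsIntegralG.ext (φ := φ) (ψ := ψ) hkn hφ hψ
  obtain ⟨φ, hφ, hφ_top⟩ := Satake.exists_integralG hn hkn
  refine ⟨Satake.existsUnique_integralP hn, ⟨φ, hφ, fun ψ hψ => uniqG _ _ hψ hφ⟩,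
    fun intP intG hP hG => ?_⟩
  -- By uniqueness, any integral is the residue functional, so `topCoeff` computes it.
  obtain rfl : intG = φ := uniqG _ _ hG hφ
  obtain ⟨I, hI⟩ := Satake.exists_satakeMap hkn
  have hiso := Satake.satakeMap_isometry hI hP hφ_top
  have hI_schubert : ∀ ν : Fin k → ℕ, StrictAnti ν → (∀ i, ν i ≤ n - 1) →
      I (exteriorPower.ιMulti ℂ k fun i => Satake.hyperplaneClass n ^ ν i) =
        Satake.schubertClass k n fun j => ν j + ((j : ℕ) + 1) - k :=
    fun ν hν _ => by rw [hI, Satake.schubertClass_eq hν]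
  refine ⟨LinearEquiv.ofBijective I ⟨Satake.satakeMap_injective hP hiso,
    Satake.satakeMap_surjective hI⟩, hI_schubert, fun L hL => ?_, hiso⟩
  exact Satake.wedge_ext fun ν hν hνn => (hL ν hν hνn).trans (hI_schubert ν hν hνn).symm
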